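/- Permutations $\sigma$ of $[n]=\{1,\dots,n\}$ ($n\ge 0$) are written as words $\sigma(1)\sigma(2)\cdots\sigma(n)$, and $|\sigma|=n$. The reduction of a word with distinct letters replaces each letter by its rank; $\sigma$ avoids a pattern $\tau$ if no subsequence of $\sigma$ has reduction $\tau$. Let $S_n(\tau)$ be the set of $\tau$-avoiding permutations of $[n]$ and $S(\tau)=\bigcup_n S_n(\tau)$. For a word $w$, $w^{+a}$ is obtained by adding $a$ to every letter, and $w^{a\rtimes b}$ by adding $b$ to every letter that is $\ge a$; $w(a\ldots b)$ denotes the factor $w(a)w(a+1)\cdots w(b)$ (empty if $a>b$), and a dot denotes concatenation. Direct sum: $\alpha\oplus\beta=\alpha\,.\,\beta^{+|\alpha|}$. Direct product: let $T(\beta)=\{i\in[|\beta|] : \beta^{-1}(i)>i<\beta(i)\}$ and $k=1+|T(\beta)|$; then $$\alpha\otimes\beta=\beta^{k\rtimes|\alpha|}(1\ldots k-1)\,.\,\alpha^{+(k-1)}\,.\,\beta^{k\rtimes|\alpha|}(k\ldots|\beta|).$$ Crossings: $\mathrm{crs}(\sigma)$ is the number of pairs $(i,j)$ of indices with $i<j<\sigma(i)<\sigma(j)$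 or $\sigma(i)<\sigma(j)\le i<j$. The Elizalde–Pak map $\Theta=\Phi^{-1}\circ\Psi$ is defined on $S_n(321)$ as follows. Let $(P,Q)$ be the insertion and recording tableaux of $\sigma\in S_n(321)$ under the Robinson–Schensted correspondence (they have at most two rows). The Dyck word $\Psi(\sigma)$ of length $2n$ has as its $i$-th step, for $i=1,\dots,n$, an up-step if $i$ is in the first row of $P$ and a down-step if $i$ is in the second row; its last $n$ steps are given, for $j$ from $n$ down to $1$, by a down-step if $j$ is in the first row of $Q$ and an up-step if $j$ is in the second row. A tunnel of a Dyck path $D$ is a horizontal segment between two lattice points of $D$ that meets $D$ only at these two points and stays below $D$; it goes from the beginning of an up-step to the end of a down-step. Number the up-steps of $D$ from left to right by $n,n-1,\dots,1$ and the down-steps from left to right by $1,2,\dots,n$. Then $\Phi^{-1}(D)(m)=j$ if and only if the tunnel starting with the up-step numbered $m$ ends with the down-step numbered $j$. **Proposition.** 1. $\Theta$ maps $S_n(321)$ into $S_n(132)$ for every $n$. 2. For all $\sigma_1,\sigma_2\in S(321)$ we have $\sigma_1\oplus\sigma_2\in S(321)$ and $$\Theta(\sigma_1\oplus\sigma_2)=\Theta(\sigma_2)\otimes\Theta(\sigma_1).$$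 3. $S(132)$ is closed under $\otimes$: if $\alpha,\beta\in S(132)$ then $\alpha\otimes\beta\in S(132)$. 4. $\otimes$ is associative on $S(132)$: $(\alpha\otimes\beta)\otimes\gamma=\alpha\otimes(\beta\otimes\gamma)$ for all $\alpha,\beta,\gamma\in S(132)$. 5. $\mathrm{crs}(\alpha\otimes\beta)=\mathrm{crs}(\alpha)+\mathrm{crs}(\beta)$ for all $\alpha,\beta\in S(132)$. -/

import Mathlib

namespace PermWord

/-! Permutations are given in one-line notation, as words `σ(1) σ(2) … σ(n)` with letters in `ℕ`.
Positions and values are numbered from `1`. -/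

/-- `w` is (the one-line notation of) a permutation of `[n] = {1, …, n}`. -/
def IsPermOf (n : ℕ) (w : List ℕ) : Prop := w.Perm (List.range' 1 n)

/-- The value `σ(i)`, for `1 ≤ i ≤ |σ|`. -/
def val (w : List ℕ) (i : ℕ) : ℕ := w.getD (i - 1) 0

/-- The value `σ⁻¹(i)`, i.e. the position of the letter `i`, for a letter `i` of `σ`. -/
def invVal (w : List ℕ) (i : ℕ) : ℕ := w.idxOf i + 1

/-- The reduction of a word with distinct letters: each letter is replaced by its rank. -/
def red (w : List ℕ) : List ℕ := w.map fun x => w.countP fun y => decide (y ≤ x)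

/-- `w` has no (not necessarily contiguous) subsequence whose reduction is `τ`. -/
def Avoids (τ w : List ℕ) : Prop := ¬ ∃ s : List ℕ, s.Sublist w ∧ red s = τ

/-- `S_n(τ)`, the set of permutations of `[n]` that avoid `τ`. -/
def avoidersOf (τ : List ℕ) (n : ℕ) : Set (List ℕ) := {w | IsPermOf n w ∧ Avoids τ w}

/-- `S(τ) = ⋃ₙ S_n(τ)`. -/
def avoiders (τ : List ℕ) : Set (List ℕ) := ⋃ n : ℕ, avoidersOf τ n

/-! ### Crossings -/

/-- The pair of indices `(i, j)` is a crossing of `σ`: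
`i < j < σ(i) < σ(j)` or `σ(i) < σ(j) ≤ i < j`. -/
def IsCrossing (w : List ℕ) (i j : ℕ) : Prop :=
  (i < j ∧ j < val w i ∧ val w i < val w j) ∨ (val w i < val w j ∧ val w j ≤ i ∧ i < j)

instance (w : List ℕ) (i j : ℕ) : Decidable (IsCrossing w i j) := by
  unfold IsCrossing; infer_instance

/-- `crs(σ)`, the number of crossings of `σ`. -/
def crs (w : List ℕ) : ℕ :=
  ((Finset.Icc 1 w.length ×ˢ Finset.Icc 1 w.length).filter
    fun p => IsCrossing w p.1 p.2).card

/-! ### Direct sum and direct product -/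

/-- `w^{+a}`: add `a` to every letter. -/
def shift (w : List ℕ) (a : ℕ) : List ℕ := w.map fun x => x + a

/-- `w^{a ⋊ b}`: add `b` to every letter that is at least `a`. -/
def shiftFrom (w : List ℕ) (a b : ℕ) : List ℕ := w.map fun x => if a ≤ x then x + b else x

/-- The direct sum `α ⊕ β = α . β^{+|α|}`. -/
def directSum (α β : List ℕ) : List ℕ := α ++ shift β α.length

/-- `T(σ) = {i ∈ [n] | σ⁻¹(i) > i < σ(i)}`. -/
def T (w : List ℕ) : Finset ℕ :=
  (Finset.Icc 1 w.length).filter fun i => i < invVal w i ∧ i < val w i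

/-- The direct product
`α ⊗ β = β^{k ⋊ |α|}(1 … k-1) . α^{+(k-1)} . β^{k ⋊ |α|}(k … |β|)` with `k = 1 + |T(β)|`,
written here with `t = k - 1 = |T(β)|`. -/
def directProd (α β : List ℕ) : List ℕ :=
  let t := (T β).card
  let β' := shiftFrom β (t + 1) α.length
  β'.take t ++ shift α t ++ β'.drop t

/-! ### The Robinson–Schensted correspondence

A tableau is the list of its rows, from the first row on. -/

/-- Insert `x` in a row: `x` replaces the leftmost letter that is larger than `x`, and this letter
is returned as the bumped one; if there is none, `x` is placed at the end of the row. -/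
def rowInsert (x : ℕ) : List ℕ → List ℕ × Option ℕ
  | [] => ([x], none)
  | y :: r => if x < y then (x :: r, some y) else (y :: (rowInsert x r).1, (rowInsert x r).2)

/-- Insert `x` in a tableau, the bumped letters being inserted in the next row. The second
component is the number (from `0`) of the row in which the new square was created. -/
def tabInsert (x : ℕ) : List (List ℕ) → List (List ℕ) × ℕ
  | [] => ([[x]], 0)
  | r :: rs =>
    match rowInsert x r with
    | (r', none) => (r' :: rs, 0)
    | (r', some y) => (r' :: (tabInsert y rs).1, (tabInsert y rs).2 + 1)

/-- Place `i` at the end of the row number `k` (from `0`) of a tableau. -/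
def placeAt (i : ℕ) : ℕ → List (List ℕ) → List (List ℕ)
  | _, [] => [[i]]
  | 0, r :: rs => (r ++ [i]) :: rs
  | k + 1, r :: rs => r :: placeAt i k rs

/-- One step: insert `(i, x) = (i, σ(i))` in the pair (insertion tableau, recording tableau). -/
def rskStep (PQ : List (List ℕ) × List (List ℕ)) (xi : ℕ × ℕ) :
    List (List ℕ) × List (List ℕ) :=
  ((tabInsert xi.1 PQ.1).1, placeAt xi.2 (tabInsert xi.1 PQ.1).2 PQ.2)

/-- The pair `(P, Q)` of insertion and recording tableaux of a word. -/
def rsk (w : List ℕ) : List (List ℕ) × List (List ℕ) :=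
  (w.zipIdx 1).foldl rskStep ([], [])

/-- The Dyck word `Ψ(σ)`, for `σ ∈ S_n(321)`, with `(P, Q) = RSK(σ)`. In its left half, for `i` from
`1` to `n`, there is an up-step if `i` is in the first row of `P` and a down-step otherwise (`i` is
then in the second row). In its right half, for `j` from `n` down to `1`, there is a down-step if
`j` is in the first row of `Q` and an up-step otherwise. -/
def Psi (w : List ℕ) : List DyckStep :=
  ((List.range' 1 w.length).map fun i =>
      if i ∈ (rsk w).1.headD [] then DyckStep.U else DyckStep.D) ++
    ((List.range' 1 w.length).reverse.map fun j =>
      if j ∈ (rsk w).2.headD [] then DyckStep.D else DyckStep.U)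

/-! ### From Dyck paths to 132-avoiding permutations -/

/-- The ordinate of the lattice point with abscissa `p` of the path `D`. -/
def height (D : List DyckStep) (p : ℕ) : ℤ :=
  ((D.take p).count DyckStep.U : ℤ) - ((D.take p).count DyckStep.D : ℤ)

/-- The horizontal segment between the lattice points of `D` with abscissas `p < q` is a tunnel:
it meets `D` only at its two end points, and stays below `D`. -/
def IsTunnel (D : List DyckStep) (p q : ℕ) : Prop :=
  p < q ∧ q ≤ D.length ∧ height D p = height D q ∧
    ∀ r ∈ Finset.Ioo p q, height D p < height D r

instance (D : List DyckStep) (p q : ℕ) : Decidable (IsTunnel D p q) := by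
  unfold IsTunnel; infer_instance

/-- The abscissa at which the tunnel that starts at the abscissa `p` ends. -/
def tunnelEnd (D : List DyckStep) (p : ℕ) : ℕ :=
  ((List.range (D.length + 1)).find? fun q => decide (IsTunnel D p q)).getD 0

/-- The abscissas at which the up-steps of `D` start, from left to right. -/
def upSteps (D : List DyckStep) : List ℕ :=
  (List.range D.length).filter fun p => decide (D[p]? = some DyckStep.U)

/-- The permutation `Φ⁻¹(D)`. From left to right, the up-steps of `D` are numbered from `n` down to
`1` and the down-steps from `1` up to `n`; then `Φ⁻¹(D)(m) = j` if and only if the tunnel that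
starts with the up-step numbered `m` ends with the down-step numbered `j`. In one-line notation the
up-steps are thus read from right to left, and the number of a down-step is the number of
down-steps up to its end. -/
def PhiInv (D : List DyckStep) : List ℕ :=
  (upSteps D).reverse.map fun p => (D.take (tunnelEnd D p)).count DyckStep.D

/-- The map `Θ = Φ⁻¹ ∘ Ψ` of Elizalde and Pak. -/
def Theta (w : List ℕ) : List ℕ := PhiInv (Psi w)

end PermWord

/-!
Let `t = |T(β)|`. The factor `α` of `α ⊗ β` occupies the square of positions and values in
`{t + 1, …, t + |α|}`, and the positions and the values of `β` both skip this interval. Hence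
crossings inside `α` or inside `β` are kept, and no crossing involves both factors. If `β` avoids
`132`, then its first `t` letters are larger than `t`, and each of its other letters larger than `t`
is a left-to-right maximum among these other letters. Such a splitting determines `t` and is
inherited by direct products; this gives the closure of `S(132)` and associativity.

If `σ` avoids `321`, each letter bumped from the first row of the insertion tableau has been bumped
by a smaller letter that stays there forever, so that at least half of the letters `≤ v` are in the
first row; this makes `Ψ(σ)` a Dyck word. The first rows of the tableaux of `σ₁ ⊕ σ₂` are those of
`σ₁` followed by those of `σ₂`, shifted, so `Ψ(σ₁ ⊕ σ₂)` is `Ψ(σ₂)` inserted at the centre of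
`Ψ(σ₁)`. The tunnels of the inserted path are those of `Ψ(σ₂)`, and those of `Ψ(σ₁)` get stretched
over it or moved along: on permutations, this is the direct product `Θ(σ₂) ⊗ Θ(σ₁)`.
-/

namespace PermWord

/-! ### Words, permutations and patterns of length three -/

theorem triplewise_iff_forall_sublist {α : Type*} {p : α → α → α → Prop} {l : List α} :
    l.Triplewise p ↔ ∀ a b c, [a, b, c].Sublist l → p a b c := by
  induction l with
  | nil => simp
  | cons x l ih =>
    rw [List.triplewise_cons, List.pairwise_iff_forall_sublist, ih]
    constructor
    · rintro ⟨hx, hl⟩ a b c h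
      rcases List.sublist_cons_iff.1 h with h | ⟨r, hr, h⟩
      · exact hl a b c h
      · obtain ⟨rfl, rfl⟩ := List.cons.inj hr
        exact hx h
    · exact fun h => ⟨fun {b c} hbc => h x b c (hbc.cons_cons x),
        fun a b c habc => h a b c (habc.cons x)⟩

theorem avoids_triple_iff {x y z : ℕ} {r : ℕ → ℕ → ℕ → Prop}
    (hr : ∀ a b c, red [a, b, c] = [x, y, z] ↔ ¬ r a b c) (w : List ℕ) :
    Avoids [x, y, z] w ↔ w.Triplewise r := by
  rw [triplewise_iff_forall_sublist, Avoids]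
  constructor
  · intro h a b c hs
    by_contra hn
    exact h ⟨_, hs, (hr a b c).2 hn⟩
  · rintro h ⟨s, hs, hred⟩
    obtain ⟨a, b, c, rfl⟩ : ∃ a b c, s = [a, b, c] :=
      List.length_eq_three.1 (by simpa [red] using congrArg List.length hred)
    exact (hr a b c).1 hred (h a b c hs)

theorem avoids_132_iff (w : List ℕ) :
    Avoids [1, 3, 2] w ↔ w.Triplewise fun a b c => a < c → b ≤ c := by
  refine avoids_triple_iff (fun a b c => ?_) w
  simp only [red, List.map_cons, List.map_nil, List.countP_cons, List.countP_nil,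
    List.cons.injEq, decide_eq_true_eq, and_true]
  split_ifs <;> omega

theorem avoids_321_iff (w : List ℕ) :
    Avoids [3, 2, 1] w ↔ w.Triplewise fun a b c => b < a → b ≤ c := by
  refine avoids_triple_iff (fun a b c => ?_) w
  simp only [red, List.map_cons, List.map_nil, List.countP_cons, List.countP_nil,
    List.cons.injEq, decide_eq_true_eq, and_true]
  split_ifs <;> omega

theorem Avoids.of_sublist {τ u w : List ℕ} (h : Avoids τ w) (hs : u.Sublist w) : Avoids τ u :=
  fun ⟨s, hsu, hred⟩ => h ⟨s, hsu.trans hs, hred⟩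

theorem IsPermOf.length_eq {n : ℕ} {w : List ℕ} (h : IsPermOf n w) : w.length = n := by
  simpa using List.Perm.length_eq h

theorem IsPermOf.nodup {n : ℕ} {w : List ℕ} (h : IsPermOf n w) : w.Nodup :=
  (List.Perm.nodup_iff h).2 List.nodup_range'

theorem IsPermOf.mem_iff {n : ℕ} {w : List ℕ} (h : IsPermOf n w) {x : ℕ} :
    x ∈ w ↔ 1 ≤ x ∧ x ≤ n := by
  rw [List.Perm.mem_iff h, List.mem_range'_1]
  omega

theorem isPermOf_of_nodup {w : List ℕ} (hd : w.Nodup) (hm : ∀ x ∈ w, 1 ≤ x ∧ x ≤ w.length) :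
    IsPermOf w.length w := by
  refine (hd.subperm fun x hx => ?_).perm_of_length_le (by simp)
  have := hm x hx
  rw [List.mem_range'_1]
  omega

theorem mem_avoiders_iff {τ w : List ℕ} :
    w ∈ avoiders τ ↔ IsPermOf w.length w ∧ Avoids τ w := by
  simp only [avoiders, avoidersOf, Set.mem_iUnion, Set.mem_ofPred_eq]
  refine ⟨?_, fun h => ⟨_, h⟩⟩
  rintro ⟨n, hn, h⟩
  exact ⟨hn.length_eq.symm ▸ hn, h⟩

theorem val_mem {w : List ℕ} {i : ℕ} (h₁ : 1 ≤ i) (h₂ : i ≤ w.length) : val w i ∈ w := by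
  rw [val, List.getD_eq_getElem _ _ (by omega)]
  exact List.getElem_mem _

theorem val_append_left {a b : List ℕ} {i : ℕ} (h₁ : 1 ≤ i) (h₂ : i ≤ a.length) :
    val (a ++ b) i = val a i :=
  List.getD_append _ _ _ _ (by omega)

theorem val_append_right {a b : List ℕ} {i : ℕ} (h : 1 ≤ i) :
    val (a ++ b) (a.length + i) = val b i := by
  rw [val, List.getD_append_right _ _ _ _ (by omega), val]
  congr 1
  omega

theorem val_map {w : List ℕ} (f : ℕ → ℕ) {i : ℕ} (h₁ : 1 ≤ i) (h₂ : i ≤ w.length) :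
    val (w.map f) i = f (val w i) := by
  rw [val, val, List.getD_eq_getElem _ _ (by rw [List.length_map]; omega),
    List.getD_eq_getElem _ _ (by omega), List.getElem_map]

/-! ### The direct sum -/

theorem length_directSum (a b : List ℕ) : (directSum a b).length = a.length + b.length := by
  rw [directSum, shift, List.length_append, List.length_map]

theorem isPermOf_directSum {a b : List ℕ} (ha : IsPermOf a.length a) (hb : IsPermOf b.length b) :
    IsPermOf (directSum a b).length (directSum a b) := by
  have hshift : (List.range' 1 b.length).map (fun x => x + a.length) =
      List.range' (1 + a.length) b.length := by
    simp only [Nat.add_comm _ a.length, List.map_add_range']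
  rw [IsPermOf, directSum, shift, List.length_append, List.length_map, ← List.range'_append_1,
    ← hshift]
  exact ha.append (hb.map _)

theorem avoids_321_directSum {a b : List ℕ} (hle : ∀ x ∈ a, x ≤ a.length)
    (ha : Avoids [3, 2, 1] a) (hb : Avoids [3, 2, 1] b) : Avoids [3, 2, 1] (directSum a b) := by
  rw [avoids_321_iff] at ha hb ⊢
  refine List.triplewise_append.2 ⟨ha, List.triplewise_map.2 (hb.imp fun h => by omega), ?_, ?_⟩
  · intro x hx
    refine List.pairwise_map.2 (List.pairwise_of_forall fun y _ hyx => ?_)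
    have := hle x hx
    omega
  · intro z hz
    obtain ⟨z, _, rfl⟩ := List.mem_map.1 hz
    refine List.pairwise_of_forall_mem_list fun x _ y hy _ => ?_
    have := hle y hy
    omega

theorem directSum_mem_avoiders {σ τ : List ℕ} (hσ : σ ∈ avoiders [3, 2, 1])
    (hτ : τ ∈ avoiders [3, 2, 1]) : directSum σ τ ∈ avoiders [3, 2, 1] := by
  rw [mem_avoiders_iff] at hσ hτ ⊢
  exact ⟨isPermOf_directSum hσ.1 hτ.1,
    avoids_321_directSum (fun x hx => (hσ.1.mem_iff.1 hx).2) hσ.2 hτ.2⟩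

/-! ### Central splits and the direct product -/

/-- The order embedding of `ℕ` in `ℕ` whose image skips the `m` integers that follow `t`. It acts
on the letters, and on the positions, of the second factor of a direct product. -/
def skip (t m x : ℕ) : ℕ := if t + 1 ≤ x then x + m else x

theorem skip_of_le {t m x : ℕ} (h : x ≤ t) : skip t m x = x := if_neg (by omega)

theorem skip_of_lt {t m x : ℕ} (h : t < x) : skip t m x = x + m := if_pos h

theorem strictMono_skip (t m : ℕ) : StrictMono (skip t m) := fun x y h => by
  simp only [skip]
  split_ifs <;> omega

theorem skip_add_add (c t m x : ℕ) : skip (t + c) m (x + c) = skip t m x + c := by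
  simp only [skip]
  split_ifs <;> omega

theorem skip_skip {s t : ℕ} (h : s ≤ t) (c m x : ℕ) :
    skip (s + c) m (skip c t x) = skip c (m + t) x := by
  simp only [skip]
  split_ifs <;> omega

theorem eq_add_or_eq_skip (t m x : ℕ) :
    (∃ y, 1 ≤ y ∧ y ≤ m ∧ x = t + y) ∨ ∃ y, x = skip t m y := by
  by_cases h₁ : x ≤ t
  · exact .inr ⟨x, (skip_of_le h₁).symm⟩
  by_cases h₂ : x ≤ t + m
  · exact .inl ⟨x - t, by omega, by omega, by omega⟩
  · exact .inr ⟨x - m, by rw [skip_of_lt] <;> omega⟩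

theorem card_T_le (w : List ℕ) : (T w).card ≤ w.length :=
  (Finset.card_filter_le _ _).trans (by simp)

theorem directProd_append {α A B : List ℕ} (h : (T (A ++ B)).card = A.length) :
    directProd α (A ++ B) = A.map (skip A.length α.length) ++
      (shift α A.length ++ B.map (skip A.length α.length)) := by
  have hmap : shiftFrom (A ++ B) (A.length + 1) α.length =
      A.map (skip A.length α.length) ++ B.map (skip A.length α.length) := List.map_append
  simp only [directProd, h, hmap]
  rw [List.take_left' (by simp), List.drop_left' (by simp), List.append_assoc]

theorem exists_append_card_T (β : List ℕ) : ∃ A B, β = A ++ B ∧ (T (A ++ B)).card = A.length :=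
  ⟨β.take (T β).card, β.drop (T β).card, (List.take_append_drop _ _).symm, by
    rw [List.take_append_drop, List.length_take, min_eq_left (card_T_le β)]⟩

theorem length_directProd (α β : List ℕ) :
    (directProd α β).length = α.length + β.length := by
  obtain ⟨A, B, rfl, h⟩ := exists_append_card_T β
  simp only [directProd_append h, shift, List.length_append, List.length_map]
  omega

theorem isPermOf_directProd {α β : List ℕ} (hα : IsPermOf α.length α) (hβ : IsPermOf β.length β) :
    IsPermOf (directProd α β).length (directProd α β) := by
  obtain ⟨A, B, rfl, h⟩ := exists_append_card_T β
  have hperm : (directProd α (A ++ B)).Perm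
      (shift α A.length ++ (A ++ B).map (skip A.length α.length)) := by
    rw [directProd_append h, List.map_append, ← List.append_assoc, ← List.append_assoc]
    exact List.perm_append_comm.append_right _
  refine isPermOf_of_nodup (hperm.nodup_iff.2 ?_) fun x hx => ?_
  · refine List.nodup_append.2 ⟨hα.nodup.map (add_left_injective _),
      hβ.nodup.map (strictMono_skip _ _).injective, ?_⟩
    simp only [shift, List.mem_map]
    rintro _ ⟨x, hx, rfl⟩ _ ⟨y, _, rfl⟩
    have := hα.mem_iff.1 hx
    simp only [skip]
    split_ifs <;> omega
  · rw [hperm.mem_iff, List.mem_append, shift, List.mem_map, List.mem_map] at hx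
    rw [length_directProd]
    rcases hx with ⟨x, hx, rfl⟩ | ⟨x, hx, rfl⟩
    · have := hα.mem_iff.1 hx
      rw [List.length_append]
      omega
    · have := hβ.mem_iff.1 hx
      simp only [skip]
      split_ifs <;> omega

/-- The word `A ++ B` splits as in the definition of the direct product: `A` has `t` letters, all
of them larger than `t`, and the letters of `B` larger than `t` are not preceded in `B` by a larger
letter. Then `t = |T(A ++ B)|`, see `IsCentralSplit.T_eq_Icc`. -/
structure IsCentralSplit (A B : List ℕ) : Prop where
  length_lt : ∀ x ∈ A, A.length < x
  pairwise : B.Pairwise fun x y => A.length < y → x ≤ y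

theorem IsCentralSplit.T_eq_Icc {A B : List ℕ} (h : IsCentralSplit A B)
    (hp : IsPermOf (A ++ B).length (A ++ B)) : T (A ++ B) = Finset.Icc 1 A.length := by
  ext i
  rw [T, Finset.mem_filter, Finset.mem_Icc, Finset.mem_Icc, invVal]
  constructor
  · rintro ⟨⟨hi, hin⟩, hinv, hval⟩
    refine ⟨hi, le_of_not_gt fun hA => ?_⟩
    have hmem : i ∈ A ++ B := hp.mem_iff.2 ⟨hi, hin⟩
    have hiA : i ∉ A := fun hiA => by
      have := List.idxOf_lt_length_of_mem hiA
      rw [List.idxOf_append_of_mem hiA] at hinv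
      omega
    have hiB : i ∈ B := (List.mem_append.1 hmem).resolve_left hiA
    obtain ⟨k, rfl⟩ := Nat.exists_eq_add_of_lt hA
    rw [List.idxOf_append_of_notMem hiA] at hinv
    rw [add_assoc, val_append_right (by omega), val] at hval
    have hlt := List.idxOf_lt_length_of_mem hiB
    have hle := List.pairwise_iff_getElem.1 h.pairwise k _ (by omega) hlt (by omega)
    rw [List.getElem_idxOf] at hle
    rw [List.getD_eq_getElem _ _ (by omega)] at hval
    have := hle hA
    simp only [Nat.add_sub_cancel] at hval
    omega
  · rintro ⟨hi, hiA⟩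
    have hmem : val A i ∈ A := val_mem hi hiA
    have := h.length_lt _ hmem
    have hiA' : i ∉ A := fun hm => by have := h.length_lt _ hm; omega
    rw [val_append_left hi hiA, List.idxOf_append_of_notMem hiA', List.length_append]
    omega

theorem IsCentralSplit.directProd_eq {A B : List ℕ} (h : IsCentralSplit A B)
    (hp : IsPermOf (A ++ B).length (A ++ B)) (α : List ℕ) :
    directProd α (A ++ B) = A.map (skip A.length α.length) ++
      (shift α A.length ++ B.map (skip A.length α.length)) :=
  directProd_append (by rw [h.T_eq_Icc hp, Nat.card_Icc, Nat.add_sub_cancel])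

theorem exists_isCentralSplit {w : List ℕ} (hw : w.Nodup) (ha : Avoids [1, 3, 2] w) :
    ∃ A B, w = A ++ B ∧ IsCentralSplit A B := by
  rw [avoids_132_iff] at ha
  let P : ℕ → Prop := fun t => ∀ x ∈ w.take t, t < x
  classical
  obtain ⟨t, ht⟩ : ∃ t, t = Nat.findGreatest P w.length := ⟨_, rfl⟩
  have htw : t ≤ w.length := ht ▸ Nat.findGreatest_le _
  have hPt : P t := ht ▸ Nat.findGreatest_spec (P := P) (m := 0) (Nat.zero_le _) (by simp [P])
  have hlen : (w.take t).length = t := by simpa using htw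
  refine ⟨w.take t, w.drop t, (List.take_append_drop t w).symm, by rwa [hlen], ?_⟩
  rw [hlen]
  rcases htw.eq_or_lt with rfl | hlt
  · simp
  obtain ⟨x, hx, hxt⟩ : ∃ x ∈ w.take (t + 1), x ≤ t + 1 := by
    simpa [P] using Nat.findGreatest_is_greatest (P := P) (k := t + 1) (by omega) hlt
  rw [← List.take_append_drop t w] at ha hw
  rw [List.take_succ_eq_append_getElem hlt, List.mem_append] at hx
  -- By maximality of `t`, the letter `t + 1` is among the first `t` letters, or else the next
  -- letter is at most `t + 1`. In both cases a descent ending above `t` would complete a pattern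
  -- `132`.
  rcases hx with hx | hx
  · have hmax : x = t + 1 := by have := hPt x hx; omega
    refine ((List.triplewise_append.1 ha).2.2.1 x hx).imp_of_mem fun {y z} _ hz hyz htz => ?_
    have := (List.nodup_append.1 hw).2.2 x hx z hz
    exact hyz (by omega)
  · have hdrop := (List.triplewise_append.1 ha).2.1
    have hnodup := (List.nodup_append.1 hw).2.1
    rw [List.drop_eq_getElem_cons hlt, ← List.mem_singleton.1 hx] at hdrop hnodup ⊢
    refine List.pairwise_cons.2 ⟨fun z _ htz => by omega, ?_⟩
    refine (List.triplewise_cons.1 hdrop).1.imp_of_mem fun {y z} _ hz hyz htz => ?_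
    have : x ≠ z := fun h => (List.nodup_cons.1 hnodup).1 (h ▸ hz)
    exact hyz (by omega)

theorem avoids_132_append_append {s t : ℕ} {A M B : List ℕ} (hAB : Avoids [1, 3, 2] (A ++ B))
    (hM : Avoids [1, 3, 2] M) (hA : ∀ x ∈ A, t < x) (hMst : ∀ x ∈ M, s < x ∧ x ≤ t)
    (hB : ∀ x ∈ B, s < x → t < x) (hBB : B.Pairwise fun x y => s < y → x ≤ y) :
    Avoids [1, 3, 2] (A ++ (M ++ B)) := by
  rw [avoids_132_iff] at hAB hM ⊢
  obtain ⟨hAAA, hBBB, hABB, hAAB⟩ := List.triplewise_append.1 hAB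
  refine List.triplewise_append.2 ⟨hAAA, List.triplewise_append.2 ⟨hM, hBBB, ?_, ?_⟩, ?_, ?_⟩
  · exact fun a ha => hBB.imp fun h hac => h ((hMst a ha).1.trans hac)
  · intro c hc
    refine List.pairwise_of_forall_mem_list fun a ha b hb hac => ?_
    have := hB c hc ((hMst a ha).1.trans hac)
    exact (hMst b hb).2.trans this.le
  · refine fun a ha => List.pairwise_append.2 ⟨?_, hABB a ha, ?_⟩
    · refine List.pairwise_of_forall_mem_list fun b _ c hc hac => ?_
      have := hA a ha
      have := hMst c hc
      omega
    · exact fun b hb c _ hac => (hMst b hb).2.trans ((hA a ha).trans hac).le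
  · refine fun c hc => (List.mem_append.1 hc).elim (fun hc => ?_) (hAAB c)
    refine List.pairwise_of_forall_mem_list fun a ha b _ hac => ?_
    have := hA a ha
    have := hMst c hc
    omega

theorem avoids_132_directProd {α β : List ℕ} (hα : ∀ x ∈ α, 1 ≤ x ∧ x ≤ α.length)
    (hβ : IsPermOf β.length β) (aα : Avoids [1, 3, 2] α) (aβ : Avoids [1, 3, 2] β) :
    Avoids [1, 3, 2] (directProd α β) := by
  obtain ⟨A, B, rfl, h⟩ := exists_isCentralSplit hβ.nodup aβ
  have hmono := strictMono_skip A.length α.length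
  rw [h.directProd_eq hβ]
  refine avoids_132_append_append (s := A.length) (t := A.length + α.length) ?_ ?_ ?_ ?_ ?_ ?_
  · rw [avoids_132_iff] at aβ ⊢
    rw [← List.map_append, List.triplewise_map]
    exact aβ.imp fun h => by rwa [hmono.lt_iff_lt, hmono.le_iff_le]
  · rw [avoids_132_iff] at aα ⊢
    exact List.triplewise_map.2 (aα.imp fun h => by omega)
  · refine List.forall_mem_map.2 fun x hx => ?_
    have := h.length_lt x hx
    rw [skip_of_lt this]
    omega
  · refine List.forall_mem_map.2 fun x hx => ?_
    have := hα x hx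
    omega
  · refine List.forall_mem_map.2 fun x _ => ?_
    simp only [skip]
    split_ifs <;> omega
  · refine List.pairwise_map.2 (h.pairwise.imp fun {x y} hxy hy => hmono.monotone (hxy ?_))
    by_contra hle
    rw [skip_of_le (by omega)] at hy
    omega

theorem directProd_mem_avoiders {α β : List ℕ} (hα : α ∈ avoiders [1, 3, 2])
    (hβ : β ∈ avoiders [1, 3, 2]) : directProd α β ∈ avoiders [1, 3, 2] := by
  rw [mem_avoiders_iff] at hα hβ ⊢
  exact ⟨isPermOf_directProd hα.1 hβ.1,
    avoids_132_directProd (fun _ => hα.1.mem_iff.1) hβ.1 hα.2 hβ.2⟩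

theorem IsCentralSplit.directProd {A B C E : List ℕ} (h : IsCentralSplit A B)
    (h' : IsCentralSplit C E) (hβ : ∀ x ∈ A ++ B, x ≤ (A ++ B).length) :
    IsCentralSplit (C.map (skip C.length (A ++ B).length) ++ shift A C.length)
      (shift B C.length ++ E.map (skip C.length (A ++ B).length)) := by
  have hn : (A ++ B).length = A.length + B.length := List.length_append
  have hlen : (C.map (skip C.length (A ++ B).length) ++ shift A C.length).length =
      C.length + A.length := by simp [shift]
  constructor
  · rw [hlen, shift, List.forall_mem_append, List.forall_mem_map, List.forall_mem_map]
    refine ⟨fun x hx => ?_, fun x hx => ?_⟩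
    · have := h'.length_lt x hx
      rw [skip_of_lt this]
      omega
    · have := h.length_lt x hx
      omega
  · rw [hlen]
    refine List.pairwise_append.2 ⟨?_, ?_, ?_⟩
    · exact List.pairwise_map.2 (h.pairwise.imp fun hxy hy => by omega)
    · refine List.pairwise_map.2 (h'.pairwise.imp fun {x y} hxy hy => ?_)
      refine (strictMono_skip _ _).monotone (hxy ?_)
      by_contra hle
      rw [skip_of_le (by omega)] at hy
      omega
    · simp only [shift, List.mem_map]
      rintro _ ⟨x, hx, rfl⟩ _ ⟨y, _, rfl⟩ hy
      have := hβ x (List.mem_append_right A hx)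
      simp only [skip] at hy ⊢
      split_ifs at hy ⊢ <;> omega

theorem directProd_assoc (α : List ℕ) {β γ : List ℕ} (hβ : β ∈ avoiders [1, 3, 2])
    (hγ : γ ∈ avoiders [1, 3, 2]) :
    directProd (directProd α β) γ = directProd α (directProd β γ) := by
  rw [mem_avoiders_iff] at hβ hγ
  obtain ⟨hβ, aβ⟩ := hβ
  obtain ⟨hγ, aγ⟩ := hγ
  have hβγ := isPermOf_directProd hβ hγ
  have hlength := length_directProd α β
  obtain ⟨A, B, rfl, h⟩ := exists_isCentralSplit hβ.nodup aβ
  obtain ⟨C, E, rfl, h'⟩ := exists_isCentralSplit hγ.nodup aγ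
  have hsplit := h.directProd h' fun x hx => (hβ.mem_iff.1 hx).2
  have hprod : directProd (A ++ B) (C ++ E) =
      (C.map (skip C.length (A ++ B).length) ++ shift A C.length) ++
        (shift B C.length ++ E.map (skip C.length (A ++ B).length)) := by
    simp only [h'.directProd_eq hγ, shift, List.map_append, List.append_assoc]
  have hskip : skip (A.length + C.length) α.length ∘ skip C.length (A ++ B).length =
      skip C.length (α.length + (A ++ B).length) :=
    funext fun x => skip_skip (by simp) _ _ x
  rw [hprod] at hβγ ⊢
  rw [hsplit.directProd_eq hβγ, h'.directProd_eq hγ, hlength, h.directProd_eq hβ]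
  have hlen : (C.map (skip C.length (A ++ B).length) ++ shift A C.length).length =
      A.length + C.length := by simp [shift, Nat.add_comm]
  rw [hlen]
  simp only [shift, List.map_append, List.map_map, List.append_assoc, hskip]
  simp only [Function.comp_def, skip_add_add, add_assoc]

/-! ### Crossings of a direct product -/

theorem val_append_append_skip {A M B : List ℕ} {i : ℕ} (hi : 1 ≤ i) :
    val (A ++ (M ++ B)) (skip A.length M.length i) = val (A ++ B) i := by
  by_cases h : i ≤ A.length
  · rw [skip_of_le h, val_append_left hi h, val_append_left hi h]
  · obtain ⟨k, hk, rfl⟩ : ∃ k, 1 ≤ k ∧ i = A.length + k := ⟨i - A.length, by omega, by omega⟩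
    rw [skip_of_lt (by omega), add_assoc, add_comm k, val_append_right (by omega),
      val_append_right (by omega), val_append_right hk]

theorem val_directProd_add (α β : List ℕ) {i : ℕ} (h₁ : 1 ≤ i) (h₂ : i ≤ α.length) :
    val (directProd α β) ((T β).card + i) = val α i + (T β).card := by
  obtain ⟨A, B, rfl, h⟩ := exists_append_card_T β
  have hlen : (A.map (skip A.length α.length)).length = A.length := List.length_map _
  have hval := val_append_right (a := A.map (skip A.length α.length))
    (b := shift α A.length ++ B.map (skip A.length α.length)) h₁
  rw [hlen] at hval
  rw [directProd_append h, h, hval, val_append_left h₁ (by simpa [shift]), shift,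
    val_map _ h₁ h₂]

theorem val_directProd_skip (α β : List ℕ) {i : ℕ} (h₁ : 1 ≤ i) (h₂ : i ≤ β.length) :
    val (directProd α β) (skip (T β).card α.length i) =
      skip (T β).card α.length (val β i) := by
  obtain ⟨A, B, rfl, h⟩ := exists_append_card_T β
  have hval := val_append_append_skip (A := A.map (skip A.length α.length))
    (M := shift α A.length) (B := B.map (skip A.length α.length)) h₁
  rw [List.length_map, shift, List.length_map] at hval
  rw [directProd_append h, h, shift, hval, ← List.map_append, val_map _ h₁ h₂]

theorem sum_Icc_eq_sum_add_sum_skip {M : Type*} [AddCommMonoid M] {t n : ℕ} (h : t ≤ n) (m : ℕ)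
    (f : ℕ → M) : ∑ i ∈ Finset.Icc 1 (m + n), f i =
      ∑ i ∈ Finset.Icc 1 m, f (t + i) + ∑ i ∈ Finset.Icc 1 n, f (skip t m i) := by
  rw [← Finset.sum_image (add_right_injective t).injOn,
    ← Finset.sum_image (strictMono_skip t m).injective.injOn, ← Finset.sum_union]
  · congr 1
    ext i
    simp only [Finset.mem_union, Finset.mem_image, Finset.mem_Icc]
    constructor
    · intro hi
      rcases eq_add_or_eq_skip t m i with ⟨j, hj, hjm, rfl⟩ | ⟨j, rfl⟩
      · exact .inl ⟨j, ⟨hj, hjm⟩, rfl⟩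
      · refine .inr ⟨j, ?_, rfl⟩
        simp only [skip] at hi
        split_ifs at hi <;> omega
    · rintro (⟨j, hj, rfl⟩ | ⟨j, hj, rfl⟩)
      · omega
      · simp only [skip]
        split_ifs <;> omega
  · simp only [Finset.disjoint_left, Finset.mem_image, Finset.mem_Icc]
    rintro _ ⟨i, hi, rfl⟩ ⟨j, _, hj⟩
    simp only [skip] at hj
    split_ifs at hj <;> omega

theorem crs_eq_sum (w : List ℕ) : crs w = ∑ i ∈ Finset.Icc 1 w.length,
    ∑ j ∈ Finset.Icc 1 w.length, if IsCrossing w i j then 1 else 0 := by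
  rw [crs, Finset.card_filter, Finset.sum_product]

section CrossingsOfProduct

variable {α β : List ℕ} {i j : ℕ}

theorem isCrossing_directProd_add_add (hi₁ : 1 ≤ i) (hi₂ : i ≤ α.length) (hj₁ : 1 ≤ j)
    (hj₂ : j ≤ α.length) :
    IsCrossing (directProd α β) ((T β).card + i) ((T β).card + j) ↔ IsCrossing α i j := by
  rw [IsCrossing, IsCrossing, val_directProd_add α β hi₁ hi₂, val_directProd_add α β hj₁ hj₂]
  omega

theorem isCrossing_directProd_skip_skip (hi₁ : 1 ≤ i) (hi₂ : i ≤ β.length) (hj₁ : 1 ≤ j)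
    (hj₂ : j ≤ β.length) :
    IsCrossing (directProd α β) (skip (T β).card α.length i) (skip (T β).card α.length j) ↔
      IsCrossing β i j := by
  have hmono := strictMono_skip (T β).card α.length
  simp only [IsCrossing, val_directProd_skip α β hi₁ hi₂, val_directProd_skip α β hj₁ hj₂,
    hmono.lt_iff_lt, hmono.le_iff_le]

theorem not_isCrossing_directProd_add_skip (hα : ∀ x ∈ α, 1 ≤ x ∧ x ≤ α.length) (hi₁ : 1 ≤ i)
    (hi₂ : i ≤ α.length) (hj₁ : 1 ≤ j) (hj₂ : j ≤ β.length) :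
    ¬ IsCrossing (directProd α β) ((T β).card + i) (skip (T β).card α.length j) := by
  rw [IsCrossing, val_directProd_add α β hi₁ hi₂, val_directProd_skip α β hj₁ hj₂]
  have := hα _ (val_mem hi₁ hi₂)
  simp only [skip]
  split_ifs <;> omega

theorem not_isCrossing_directProd_skip_add (hα : ∀ x ∈ α, 1 ≤ x ∧ x ≤ α.length) (hi₁ : 1 ≤ i)
    (hi₂ : i ≤ β.length) (hj₁ : 1 ≤ j) (hj₂ : j ≤ α.length) :
    ¬ IsCrossing (directProd α β) (skip (T β).card α.length i) ((T β).card + j) := by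
  rw [IsCrossing, val_directProd_add α β hj₁ hj₂, val_directProd_skip α β hi₁ hi₂]
  have := hα _ (val_mem hj₁ hj₂)
  simp only [skip]
  split_ifs <;> omega

end CrossingsOfProduct

theorem crs_directProd {α : List ℕ} (hα : ∀ x ∈ α, 1 ≤ x ∧ x ≤ α.length) (β : List ℕ) :
    crs (directProd α β) = crs α + crs β := by
  rw [crs_eq_sum, crs_eq_sum α, crs_eq_sum β, length_directProd,
    sum_Icc_eq_sum_add_sum_skip (card_T_le β)]
  congr 1 <;> refine Finset.sum_congr rfl fun i hi => ?_ <;>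
    rw [sum_Icc_eq_sum_add_sum_skip (card_T_le β)] <;> rw [Finset.mem_Icc] at hi
  · rw [Finset.sum_eq_zero (s := Finset.Icc 1 β.length), add_zero]
    · refine Finset.sum_congr rfl fun j hj => ?_
      rw [Finset.mem_Icc] at hj
      simp only [isCrossing_directProd_add_add hi.1 hi.2 hj.1 hj.2]
    · intro j hj
      rw [Finset.mem_Icc] at hj
      exact if_neg (not_isCrossing_directProd_add_skip hα hi.1 hi.2 hj.1 hj.2)
  · rw [Finset.sum_eq_zero (s := Finset.Icc 1 α.length), zero_add]
    · refine Finset.sum_congr rfl fun j hj => ?_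
      rw [Finset.mem_Icc] at hj
      simp only [isCrossing_directProd_skip_skip hi.1 hi.2 hj.1 hj.2]
    · intro j hj
      rw [Finset.mem_Icc] at hj
      exact if_neg (not_isCrossing_directProd_skip_add hα hi.1 hi.2 hj.1 hj.2)

/-! ### Tunnels and the inverse of `Φ` -/

open DyckStep

theorem height_append_of_le {P Q : List DyckStep} {p : ℕ} (h : p ≤ P.length) :
    height (P ++ Q) p = height P p := by
  rw [height, height, List.take_append_of_le_length h]

theorem height_append_length_add (P Q : List DyckStep) (p : ℕ) :
    height (P ++ Q) (P.length + p) = height P P.length + height Q p := by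
  simp only [height, List.take_length_add_append, List.take_length, List.count_append]
  push_cast
  ring

theorem height_succ_of_up {P : List DyckStep} {p : ℕ} (h : P[p]? = some U) :
    height P (p + 1) = height P p + 1 := by
  have hU : [U].count U = 1 := rfl
  have hD : [U].count D = 0 := rfl
  simp only [height, List.take_add_one, h, Option.toList_some, List.count_append, hU, hD]
  push_cast
  ring

theorem height_sub_one_le_height_succ (P : List DyckStep) (p : ℕ) :
    height P p - 1 ≤ height P (p + 1) := by
  have hstep : P[p]?.toList.count D ≤ 1 := by rcases P[p]? with _ | _ | _ <;> decide
  simp only [height, List.take_add_one, List.count_append]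
  omega

theorem height_nonneg (P : DyckWord) (p : ℕ) : 0 ≤ height P.toList p := by
  have := P.count_D_le_count_U p
  rw [height]
  omega

theorem height_length (P : DyckWord) : height P.toList P.toList.length = 0 := by
  have := P.count_U_eq_count_D
  rw [height, List.take_length]
  omega

theorem mem_upSteps {P : List DyckStep} {p : ℕ} : p ∈ upSteps P ↔ P[p]? = some U := by
  simp only [upSteps, List.mem_filter, List.mem_range, decide_eq_true_eq, and_iff_right_iff_imp]
  exact fun h => (List.getElem?_eq_some_iff.1 h).1

theorem upSteps_append (P Q : List DyckStep) :
    upSteps (P ++ Q) = upSteps P ++ (upSteps Q).map (P.length + ·) := by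
  rw [upSteps, List.length_append, List.range_add, List.filter_append, List.filter_map]
  congr 1
  · refine List.filter_congr fun p hp => ?_
    rw [List.getElem?_append_left (List.mem_range.1 hp)]
  · refine congrArg _ (List.filter_congr fun p _ => ?_)
    simp only [Function.comp, List.getElem?_append_right (Nat.le_add_right _ _),
      Nat.add_sub_cancel_left]

theorem length_upSteps (P : List DyckStep) : (upSteps P).length = P.count U := by
  induction P using List.reverseRecOn with
  | nil => rfl
  | append_singleton P x ih =>
    rw [upSteps_append, List.length_append, ih, List.length_map, List.count_append]
    cases x <;> rfl

theorem pairwise_upSteps (P : List DyckStep) : (upSteps P).Pairwise (· < ·) :=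
  List.pairwise_lt_range.filter _

section Tunnels

variable {P Q : List DyckStep} {p q p' q' : ℕ}

theorem exists_isTunnel_of_height_le (hp : p ∈ upSteps P) (hpq : p < q) (hq : q ≤ P.length)
    (hle : height P q ≤ height P p) : ∃ r, IsTunnel P p r := by
  classical
  have hex : ∃ r, p < r ∧ height P r ≤ height P p := ⟨q, hpq, hle⟩
  obtain ⟨r, hr⟩ : ∃ r, r = Nat.find hex := ⟨_, rfl⟩
  obtain ⟨hpr, hr_le⟩ := hr ▸ Nat.find_spec hex
  have hbetween : ∀ s ∈ Finset.Ioo p r, height P p < height P s := fun s hs => by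
    rw [Finset.mem_Ioo] at hs
    by_contra hs'
    exact Nat.find_min hex (hr ▸ hs.2) ⟨hs.1, not_lt.1 hs'⟩
  refine ⟨r, hpr, (hr ▸ Nat.find_min' hex ⟨hpq, hle⟩).trans hq, le_antisymm ?_ hr_le, hbetween⟩
  obtain ⟨s, rfl⟩ := Nat.exists_eq_add_of_lt hpr
  have hup := height_succ_of_up (mem_upSteps.1 hp)
  rcases s.eq_zero_or_pos with rfl | hs
  · exact (lt_add_one _).le.trans hup.ge
  · have := hbetween (p + s) (Finset.mem_Ioo.2 ⟨by omega, by omega⟩)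
    have := height_sub_one_le_height_succ P (p + s)
    omega

theorem IsTunnel.unique (h : IsTunnel P p q) (h' : IsTunnel P p q') : q = q' := by
  obtain ⟨hpq, _, heq, hlt⟩ := h
  obtain ⟨hpq', _, heq', hlt'⟩ := h'
  rcases lt_trichotomy q q' with hq | hq | hq
  · exact absurd (hlt' q (Finset.mem_Ioo.2 ⟨hpq, hq⟩)) heq.not_lt
  · exact hq
  · exact absurd (hlt q' (Finset.mem_Ioo.2 ⟨hpq', hq⟩)) heq'.not_lt

theorem IsTunnel.tunnelEnd_eq (h : IsTunnel P p q) : tunnelEnd P p = q := by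
  have hsome : ((List.range (P.length + 1)).find? fun q => decide (IsTunnel P p q)).isSome :=
    List.find?_isSome.2 ⟨q, List.mem_range.2 (Nat.lt_succ_of_le h.2.1), decide_eq_true h⟩
  obtain ⟨r, hr⟩ := Option.isSome_iff_exists.1 hsome
  rw [tunnelEnd, hr]
  have hr' := List.find?_some hr
  exact (of_decide_eq_true hr').unique h

theorem IsTunnel.getElem?_pred (h : IsTunnel P p q) (hp : p ∈ upSteps P) :
    P[q - 1]? = some D := by
  obtain ⟨hpq, hq, heq, hlt⟩ := h
  obtain ⟨s, rfl⟩ := Nat.exists_eq_add_of_lt hpq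
  rw [Nat.add_sub_cancel, List.getElem?_eq_getElem (by omega)]
  refine congrArg some ((dichotomy _).resolve_left fun hU => ?_)
  have hup := height_succ_of_up (List.getElem?_eq_some_iff.2 ⟨_, hU⟩)
  rcases s.eq_zero_or_pos with rfl | hs
  · have := height_succ_of_up (mem_upSteps.1 hp)
    simp only [add_zero] at *
    omega
  · have := hlt (p + s) (Finset.mem_Ioo.2 ⟨by omega, by omega⟩)
    omega

theorem IsTunnel.lt_of_lt_of_lt (h : IsTunnel P p q) (h' : IsTunnel P p' q') (hp : p < p')
    (hp' : p' < q) : q' < q := by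
  have hlt := h.2.2.2 p' (Finset.mem_Ioo.2 ⟨hp, hp'⟩)
  have heq := h.2.2.1
  have heq' := h'.2.2.1
  rcases lt_trichotomy q' q with hq | rfl | hq
  · exact hq
  · omega
  · have := h'.2.2.2 q (Finset.mem_Ioo.2 ⟨hp', hq⟩)
    omega

theorem isTunnel_append_iff_of_le (hq : q ≤ P.length) :
    IsTunnel (P ++ Q) p q ↔ IsTunnel P p q := by
  simp only [IsTunnel, List.length_append]
  refine and_congr_right fun hpq => ?_
  rw [height_append_of_le hq, height_append_of_le (hpq.le.trans hq)]
  refine and_congr (by omega) (and_congr_right fun _ => forall₂_congr fun r hr => ?_)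
  rw [height_append_of_le ((Finset.mem_Ioo.1 hr).2.le.trans hq)]

theorem isTunnel_append_length_add_iff :
    IsTunnel (P ++ Q) (P.length + p) (P.length + q) ↔ IsTunnel Q p q := by
  simp only [IsTunnel, List.length_append, height_append_length_add, add_lt_add_iff_left,
    add_le_add_iff_left, add_right_inj]
  refine and_congr_right fun _ => and_congr_right fun _ => and_congr_right fun _ => ?_
  constructor
  · intro h r hr
    rw [Finset.mem_Ioo] at hr
    have := h (P.length + r) (Finset.mem_Ioo.2 ⟨by omega, by omega⟩)
    rw [height_append_length_add] at this
    omega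
  · intro h r hr
    rw [Finset.mem_Ioo] at hr
    obtain ⟨r, rfl⟩ := Nat.exists_eq_add_of_le (show P.length ≤ r by omega)
    have := h r (Finset.mem_Ioo.2 ⟨by omega, by omega⟩)
    rw [height_append_length_add]
    omega

end Tunnels

/-- Every up-step of `P` starts a tunnel. This holds for the suffixes of Dyck words. -/
def UpStepsMatched (P : List DyckStep) : Prop := ∀ p ∈ upSteps P, ∃ q, IsTunnel P p q

theorem UpStepsMatched.isTunnel {P : List DyckStep} (h : UpStepsMatched P) {p : ℕ}
    (hp : p ∈ upSteps P) : IsTunnel P p (tunnelEnd P p) := by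
  obtain ⟨q, hq⟩ := h p hp
  rwa [hq.tunnelEnd_eq]

theorem upStepsMatched_dyckWord (P : DyckWord) : UpStepsMatched P.toList := fun p hp =>
  exists_isTunnel_of_height_le hp (List.getElem?_eq_some_iff.1 (mem_upSteps.1 hp)).1 le_rfl
    (by rw [height_length]; exact height_nonneg P p)

theorem UpStepsMatched.of_append {P Q : List DyckStep} (h : UpStepsMatched (P ++ Q)) :
    UpStepsMatched Q := by
  intro p hp
  have hp' : P.length + p ∈ upSteps (P ++ Q) := by
    rw [upSteps_append]
    exact List.mem_append_right _ (List.mem_map_of_mem hp)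
  obtain ⟨q, hq⟩ := h _ hp'
  obtain ⟨q, rfl⟩ := Nat.exists_eq_add_of_le (show P.length ≤ q by have := hq.1; omega)
  exact ⟨q, isTunnel_append_length_add_iff.1 hq⟩

/-- The number of down-steps of `P` that end at the abscissa `q` or before. -/
def downs (P : List DyckStep) (q : ℕ) : ℕ := (P.take q).count D

theorem downs_mono (P : List DyckStep) : Monotone (downs P) := fun _ _ h =>
  (List.take_sublist_take_left h).count_le _

theorem downs_le_count (P : List DyckStep) (q : ℕ) : downs P q ≤ P.count D :=
  (List.take_sublist q P).count_le _

theorem downs_append_length_add (P Q : List DyckStep) (q : ℕ) :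
    downs (P ++ Q) (P.length + q) = P.count D + downs Q q := by
  rw [downs, downs, List.take_length_add_append, List.count_append]

theorem downs_lt_downs {P : List DyckStep} {q r : ℕ} (h : q < r) (hr : P[r - 1]? = some D) :
    downs P q < downs P r := by
  obtain ⟨s, rfl⟩ := Nat.exists_eq_add_of_lt h
  refine (downs_mono P (Nat.le_add_right q s)).trans_lt ?_
  rw [Nat.add_sub_cancel] at hr
  simp [downs, List.take_add_one, hr]

theorem PhiInv_eq_map_downs (P : List DyckStep) :
    PhiInv P = (upSteps P).reverse.map fun p => downs P (tunnelEnd P p) := rfl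

theorem length_PhiInv (P : List DyckStep) : (PhiInv P).length = P.count U := by
  rw [PhiInv, List.length_map, List.length_reverse, length_upSteps]

section PhiInv

variable {P : List DyckStep} {p p' : ℕ}

theorem UpStepsMatched.downs_tunnelEnd_lt_iff (h : UpStepsMatched P) (hp' : p' ∈ upSteps P) :
    downs P (tunnelEnd P p) < downs P (tunnelEnd P p') ↔ tunnelEnd P p < tunnelEnd P p' :=
  ⟨fun hlt => (downs_mono P).reflect_lt hlt,
    fun hlt => downs_lt_downs hlt ((h.isTunnel hp').getElem?_pred hp')⟩

theorem UpStepsMatched.tunnelEnd_injOn (h : UpStepsMatched P) :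
    ∀ p ∈ upSteps P, ∀ p' ∈ upSteps P, tunnelEnd P p = tunnelEnd P p' → p = p' := by
  intro p hp p' hp' heq
  have ht := h.isTunnel hp
  have ht' := h.isTunnel hp'
  rcases lt_trichotomy p p' with hlt | hpp | hlt
  · exact absurd (ht.lt_of_lt_of_lt ht' hlt (heq ▸ ht'.1)) heq.not_gt
  · exact hpp
  · exact absurd (ht'.lt_of_lt_of_lt ht hlt (heq ▸ ht.1)) heq.not_lt

theorem UpStepsMatched.mem_PhiInv (h : UpStepsMatched P) {x : ℕ} (hx : x ∈ PhiInv P) :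
    1 ≤ x ∧ x ≤ P.count D := by
  rw [PhiInv_eq_map_downs] at hx
  obtain ⟨p, hp, rfl⟩ := List.mem_map.1 hx
  rw [List.mem_reverse] at hp
  have ht := h.isTunnel hp
  have := downs_lt_downs (Nat.zero_lt_of_lt ht.1) (ht.getElem?_pred hp)
  exact ⟨by omega, downs_le_count P _⟩

theorem UpStepsMatched.nodup_PhiInv (h : UpStepsMatched P) : (PhiInv P).Nodup := by
  rw [PhiInv_eq_map_downs]
  refine List.Nodup.map_on (fun p hp p' hp' heq => ?_)
    (List.nodup_reverse.2 ((pairwise_upSteps P).imp ne_of_lt))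
  rw [List.mem_reverse] at hp hp'
  refine h.tunnelEnd_injOn p hp p' hp' (le_antisymm ?_ ?_)
  · exact not_lt.1 ((h.downs_tunnelEnd_lt_iff hp).not.1 heq.not_gt)
  · exact not_lt.1 ((h.downs_tunnelEnd_lt_iff hp').not.1 heq.not_lt)

theorem UpStepsMatched.isPermOf_PhiInv (h : UpStepsMatched P) (hP : P.count D ≤ P.count U) :
    IsPermOf (PhiInv P).length (PhiInv P) := by
  refine isPermOf_of_nodup h.nodup_PhiInv fun x hx => ?_
  have := h.mem_PhiInv hx
  rw [length_PhiInv]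
  omega

theorem UpStepsMatched.avoids_132_PhiInv (h : UpStepsMatched P) :
    Avoids [1, 3, 2] (PhiInv P) := by
  rw [avoids_132_iff, PhiInv_eq_map_downs, List.triplewise_map, triplewise_iff_forall_sublist]
  intro x y z hs hxz
  have hmem : ∀ p ∈ [x, y, z], p ∈ upSteps P := fun p hp => List.mem_reverse.1 (hs.subset hp)
  obtain ⟨hx, hy, hz⟩ : x ∈ upSteps P ∧ y ∈ upSteps P ∧ z ∈ upSteps P := by simpa using hmem
  have hzyx : z < y ∧ y < x := by
    have := (List.pairwise_reverse.2 (pairwise_upSteps P)).sublist hs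
    simp only [List.pairwise_cons, List.mem_cons, List.not_mem_nil, or_false, forall_eq_or_imp,
      forall_eq] at this
    exact ⟨this.2.1, this.1.1⟩
  rw [h.downs_tunnelEnd_lt_iff hz] at hxz
  have hyz := (h.isTunnel hz).lt_of_lt_of_lt (h.isTunnel hy) hzyx.1
    ((hzyx.2.trans (h.isTunnel hx).1).trans hxz)
  exact downs_mono P hyz.le

end PhiInv

theorem PhiInv_mem_avoidersOf (P : DyckWord) :
    PhiInv P.toList ∈ avoidersOf [1, 3, 2] (P.toList.count U) := by
  have h := upStepsMatched_dyckWord P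
  exact length_PhiInv P.toList ▸ ⟨h.isPermOf_PhiInv P.count_U_eq_count_D.ge, h.avoids_132_PhiInv⟩

/-! ### Insertion of a Dyck word at the centre of a Dyck word -/

theorem UpStepsMatched.append {P Q : List DyckStep} (hP : UpStepsMatched P)
    (hQ : UpStepsMatched Q) : UpStepsMatched (P ++ Q) := by
  intro p hp
  rw [upSteps_append, List.mem_append, List.mem_map] at hp
  rcases hp with hp | ⟨p, hp, rfl⟩
  · have h := hP.isTunnel hp
    exact ⟨_, (isTunnel_append_iff_of_le h.2.1).2 h⟩
  · exact ⟨_, isTunnel_append_length_add_iff.2 (hQ.isTunnel hp)⟩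

theorem downs_append_of_le {P Q : List DyckStep} {q : ℕ} (h : q ≤ P.length) :
    downs (P ++ Q) q = downs P q := by
  rw [downs, downs, List.take_append_of_le_length h]

theorem downs_append_length (P Q : List DyckStep) : downs (P ++ Q) P.length = P.count D := by
  rw [downs, List.take_left']
  rfl

theorem PhiInv_append {R : List DyckStep} (hR : UpStepsMatched R) (L : List DyckStep) :
    PhiInv (L ++ R) = shift (PhiInv R) (L.count D) ++
      (upSteps L).reverse.map fun p => downs (L ++ R) (tunnelEnd (L ++ R) p) := by
  rw [PhiInv_eq_map_downs, upSteps_append, List.reverse_append, List.map_append,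
    ← List.map_reverse, List.map_map, PhiInv_eq_map_downs, shift, List.map_map]
  refine congrArg (· ++ _) (List.map_congr_left fun p hp => ?_)
  have h := hR.isTunnel (List.mem_reverse.1 hp)
  rw [Function.comp_apply, (isTunnel_append_length_add_iff.2 h).tunnelEnd_eq,
    downs_append_length_add, Function.comp_apply, add_comm]

theorem PhiInv_append_of_upStepsMatched {P Q : List DyckStep} (hP : UpStepsMatched P)
    (hQ : UpStepsMatched Q) : PhiInv (P ++ Q) = shift (PhiInv Q) (P.count D) ++ PhiInv P := by
  rw [PhiInv_append hQ, PhiInv_eq_map_downs P]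
  refine congrArg (shift (PhiInv Q) (P.count D) ++ ·) (List.map_congr_left fun p hp => ?_)
  have h := hP.isTunnel (List.mem_reverse.1 hp)
  rw [((isTunnel_append_iff_of_le h.2.1).2 h).tunnelEnd_eq, downs_append_of_le h.2.1]

section Insertion

variable {L R : List DyckStep}

theorem mem_upSteps_append_left {p : ℕ} (hp : p ∈ upSteps L) : p ∈ upSteps (L ++ R) := by
  rw [upSteps_append]
  exact List.mem_append_left _ hp

theorem isCentralSplit_PhiInv_append (h : UpStepsMatched (L ++ R))
    (hcount : L.count D = R.count U) :
    IsCentralSplit (shift (PhiInv R) (L.count D))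
      ((upSteps L).reverse.map fun p => downs (L ++ R) (tunnelEnd (L ++ R) p)) := by
  have hlen : (shift (PhiInv R) (L.count D)).length = L.count D := by
    rw [shift, List.length_map, length_PhiInv, hcount]
  constructor
  · rw [hlen, shift, List.forall_mem_map]
    intro x hx
    have := h.of_append.mem_PhiInv hx
    omega
  · rw [hlen]
    refine List.pairwise_map.2 ((List.pairwise_reverse.2 (pairwise_upSteps L)).imp_of_mem ?_)
    intro p q hp hq hqp hlt
    rw [List.mem_reverse] at hp hq
    have hpL : p < L.length := (List.getElem?_eq_some_iff.1 (mem_upSteps.1 hp)).1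
    have hend : L.length < tunnelEnd (L ++ R) q := by
      rw [← downs_append_length L R] at hlt
      exact (downs_mono _).reflect_lt hlt
    exact downs_mono _ ((h.isTunnel (mem_upSteps_append_left hq)).lt_of_lt_of_lt
      (h.isTunnel (mem_upSteps_append_left hp)) hqp (hpL.trans hend)).le

theorem height_insert_skip (L R : List DyckStep) (E : DyckWord) (x : ℕ) :
    height (L ++ (E.toList ++ R)) (skip L.length E.toList.length x) = height (L ++ R) x := by
  by_cases hx : x ≤ L.length
  · rw [skip_of_le hx, height_append_of_le hx, height_append_of_le hx]
  · obtain ⟨y, rfl⟩ := Nat.exists_eq_add_of_le (not_le.1 hx).le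
    rw [skip_of_lt (not_le.1 hx), add_assoc, add_comm y, height_append_length_add,
      height_append_length_add, height_append_length_add, height_length, zero_add]

theorem IsTunnel.insert {p q : ℕ} (h : IsTunnel (L ++ R) p q) (hp : p < L.length)
    (E : DyckWord) :
    IsTunnel (L ++ (E.toList ++ R)) p (skip L.length E.toList.length q) := by
  obtain ⟨hpq, hq, heq, hlt⟩ := h
  have hmono := strictMono_skip L.length E.toList.length
  have hpp : skip L.length E.toList.length p = p := skip_of_le hp.le
  have hheight := height_insert_skip L R E
  rw [← hpp]
  refine ⟨hmono hpq, ?_, by rw [hheight, hheight, heq], fun r hr => ?_⟩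
  · simp only [skip, List.length_append] at hq ⊢
    split_ifs <;> omega
  rw [Finset.mem_Ioo] at hr
  rw [hheight]
  rcases eq_add_or_eq_skip L.length E.toList.length r with ⟨y, _, hy, rfl⟩ | ⟨y, rfl⟩
  · have hLq : L.length < q := by
      by_contra hle
      rw [skip_of_le (not_lt.1 hle)] at hr
      omega
    have hlow := hlt L.length (Finset.mem_Ioo.2 ⟨hp, hLq⟩)
    have := height_nonneg E y
    rw [height_append_of_le le_rfl] at hlow
    rw [height_append_length_add, height_append_of_le hy]
    omega
  · rw [hheight]
    exact hlt y (Finset.mem_Ioo.2 ⟨hmono.lt_iff_lt.1 hr.1, hmono.lt_iff_lt.1 hr.2⟩)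

theorem IsTunnel.downs_insert {p q : ℕ} (h : IsTunnel (L ++ R) p q) (hp : p ∈ upSteps (L ++ R))
    (E : DyckWord) : downs (L ++ (E.toList ++ R)) (skip L.length E.toList.length q) =
      skip (L.count D) (E.toList.count D) (downs (L ++ R) q) := by
  by_cases hq : q ≤ L.length
  · rw [skip_of_le hq, downs_append_of_le hq, downs_append_of_le hq,
      skip_of_le (downs_le_count L q)]
  · have hlt := downs_lt_downs (not_le.1 hq) (h.getElem?_pred hp)
    rw [downs_append_length] at hlt
    rw [skip_of_lt hlt, skip_of_lt (not_le.1 hq)]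
    obtain ⟨y, rfl⟩ := Nat.exists_eq_add_of_le (not_le.1 hq).le
    rw [add_assoc, add_comm y, downs_append_length_add, downs_append_length_add,
      downs_append_length_add]
    omega

theorem PhiInv_insert {P : DyckWord} (hP : P.toList = L ++ R) (hcount : L.count D = R.count U)
    (E : DyckWord) :
    PhiInv (L ++ (E.toList ++ R)) = directProd (PhiInv E.toList) (PhiInv (L ++ R)) := by
  have hLR : UpStepsMatched (L ++ R) := hP ▸ upStepsMatched_dyckWord P
  have hR := hLR.of_append
  have hE := upStepsMatched_dyckWord E
  have hperm := hLR.isPermOf_PhiInv (hP ▸ P.count_U_eq_count_D.ge)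
  rw [PhiInv_append hR] at hperm ⊢
  rw [(isCentralSplit_PhiInv_append hLR hcount).directProd_eq hperm, PhiInv_append (hE.append hR),
    PhiInv_append_of_upStepsMatched hE hR, length_PhiInv, E.count_U_eq_count_D]
  simp only [shift, List.map_append, List.map_map, List.length_map, length_PhiInv, ← hcount,
    List.append_assoc]
  refine congrArg₂ (· ++ ·) (List.map_congr_left fun x hx => ?_)
    (congrArg _ (List.map_congr_left fun p hp => ?_))
  · have := hR.mem_PhiInv hx
    rw [Function.comp_apply, Function.comp_apply, skip_of_lt (by omega)]
    omega
  · rw [List.mem_reverse] at hp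
    have hp' := mem_upSteps_append_left (R := R) hp
    have ht := hLR.isTunnel hp'
    rw [Function.comp_apply, ← ht.downs_insert hp' E,
      (ht.insert (List.getElem?_eq_some_iff.1 (mem_upSteps.1 hp)).1 E).tunnelEnd_eq]

end Insertion

/-! ### The first rows of the Robinson–Schensted tableaux -/

theorem rowInsert_eq_none {x : ℕ} {r : List ℕ} (h : (rowInsert x r).2 = none) :
    (rowInsert x r).1 = r ++ [x] := by
  induction r with
  | nil => rfl
  | cons y r ih =>
    simp only [rowInsert] at h ⊢
    split_ifs at h ⊢
    rw [ih h, List.cons_append]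

theorem rowInsert_eq_some {x y : ℕ} {r : List ℕ} (h : (rowInsert x r).2 = some y) :
    x < y ∧ (y :: (rowInsert x r).1).Perm (x :: r) := by
  induction r with
  | nil => cases h
  | cons z r ih =>
    simp only [rowInsert] at h ⊢
    split_ifs at h ⊢ with hz
    · cases h
      exact ⟨hz, List.Perm.swap _ _ _⟩
    · obtain ⟨hlt, hperm⟩ := ih h
      exact ⟨hlt, (List.Perm.swap _ _ _).trans ((hperm.cons z).trans (List.Perm.swap _ _ _))⟩

theorem rowInsert_append {x : ℕ} {a : List ℕ} (h : ∀ y ∈ a, y ≤ x) (b : List ℕ) :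
    rowInsert x (a ++ b) = (a ++ (rowInsert x b).1, (rowInsert x b).2) := by
  induction a with
  | nil => rfl
  | cons y a ih =>
    rw [List.forall_mem_cons] at h
    rw [List.cons_append, rowInsert, if_neg h.1.not_gt, ih h.2]
    rfl

theorem rowInsert_shift (x m : ℕ) (r : List ℕ) : rowInsert (x + m) (shift r m) =
    (shift (rowInsert x r).1 m, (rowInsert x r).2.map (· + m)) := by
  induction r with
  | nil => rfl
  | cons y r ih =>
    rw [shift, List.map_cons, ← shift, rowInsert, rowInsert, ih]
    by_cases h : x < y
    · rw [if_pos h, if_pos (Nat.add_lt_add_right h m)]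
      rfl
    · rw [if_neg h, if_neg (by omega)]
      rfl

/-- The first row of the insertion tableau of `w`. -/
def insertionRow (w : List ℕ) : List ℕ := (rsk w).1.headD []

/-- The first row of the recording tableau of `w`. -/
def recordingRow (w : List ℕ) : List ℕ := (rsk w).2.headD []

theorem rsk_append_singleton (w : List ℕ) (x : ℕ) :
    rsk (w ++ [x]) = rskStep (rsk w) (x, w.length + 1) := by
  rw [rsk, List.zipIdx_append, List.foldl_append, Nat.add_comm]
  rfl

theorem insertionRow_append_singleton (w : List ℕ) (x : ℕ) :
    insertionRow (w ++ [x]) = (rowInsert x (insertionRow w)).1 := by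
  rw [insertionRow, insertionRow, rsk_append_singleton, rskStep]
  cases (rsk w).1 with
  | nil => rfl
  | cons r rs =>
    rw [tabInsert, List.headD_cons]
    rcases rowInsert x r with ⟨_, _ | _⟩ <;> rfl

theorem rsk_snd_ne_nil {w : List ℕ} (h : w ≠ []) : (rsk w).2 ≠ [] := by
  obtain ⟨u, x, rfl⟩ := (List.eq_nil_or_concat' w).resolve_left h
  rw [rsk_append_singleton, rskStep]
  cases (rsk u).2 <;> cases (tabInsert x (rsk u).1).2 <;> exact List.cons_ne_nil _ _

theorem recordingRow_append_singleton (w : List ℕ) (x : ℕ) :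
    recordingRow (w ++ [x]) = if (rowInsert x (insertionRow w)).2 = none then
      recordingRow w ++ [w.length + 1] else recordingRow w := by
  rcases eq_or_ne w [] with rfl | hw
  · rfl
  rw [insertionRow, recordingRow, recordingRow, rsk_append_singleton, rskStep]
  obtain ⟨q, qs, hQ⟩ := List.exists_cons_of_ne_nil (rsk_snd_ne_nil hw)
  rw [hQ]
  cases (rsk w).1 with
  | nil => rfl
  | cons r rs =>
    rw [tabInsert, List.headD_cons]
    rcases rowInsert x r with ⟨_, _ | _⟩ <;> rfl

theorem insertionRow_subperm (w : List ℕ) : (insertionRow w).Subperm w := by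
  induction w using List.reverseRecOn with
  | nil => exact List.Subperm.refl _
  | append_singleton w x ih =>
    have hcons : (x :: insertionRow w).Subperm (w ++ [x]) :=
      ((List.subperm_cons x).2 ih).trans (List.perm_append_singleton x w).symm.subperm
    rw [insertionRow_append_singleton]
    cases h : (rowInsert x (insertionRow w)).2 with
    | none =>
      rw [rowInsert_eq_none h]
      exact (List.subperm_append_right _).2 ih
    | some y =>
      exact (List.sublist_cons_self y _).subperm.trans
        ((rowInsert_eq_some h).2.subperm.trans hcons)

theorem length_insertionRow (w : List ℕ) : (insertionRow w).length = (recordingRow w).length := by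
  induction w using List.reverseRecOn with
  | nil => rfl
  | append_singleton w x ih =>
    rw [insertionRow_append_singleton, recordingRow_append_singleton]
    cases h : (rowInsert x (insertionRow w)).2 with
    | none =>
      rw [rowInsert_eq_none h, if_pos rfl, List.length_append, List.length_append, ih]
      rfl
    | some y =>
      rw [if_neg (Option.some_ne_none y), ← ih]
      exact Nat.succ_injective (rowInsert_eq_some h).2.length_eq

theorem recordingRow_sublist (w : List ℕ) :
    (recordingRow w).Sublist (List.range' 1 w.length) := by
  induction w using List.reverseRecOn with
  | nil => exact List.Sublist.refl _
  | append_singleton w x ih =>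
    rw [recordingRow_append_singleton, List.length_append, List.length_singleton,
      List.range'_concat, one_mul, Nat.add_comm 1]
    split_ifs
    · exact ih.append_right _
    · exact ih.trans (List.sublist_append_left _ _)

theorem recordingRow_take (w : List ℕ) {j : ℕ} (hj : j ≤ w.length) :
    recordingRow (w.take j) = (recordingRow w).filter fun i => decide (i ≤ j) := by
  induction w using List.reverseRecOn with
  | nil => rw [List.take_nil]; rfl
  | append_singleton w x ih =>
    rcases hj.eq_or_lt with rfl | hlt
    · rw [List.take_length, eq_comm, List.filter_eq_self]
      intro i hi
      have := List.mem_range'_1.1 ((recordingRow_sublist _).subset hi)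
      exact decide_eq_true (by omega)
    · rw [List.length_append, List.length_singleton] at hlt
      rw [List.take_append_of_le_length (by omega), ih (by omega), recordingRow_append_singleton]
      split_ifs
      · rw [List.filter_append, List.filter_singleton, decide_eq_false (by omega)]
        exact (List.append_nil _).symm
      · rfl

/-- `b` lists the letters that left the first row of the insertion tableau of `w`, and `c` the
letters that bumped them, in the same order; the letters in `c` stay in the first row. The last
condition is the invariant thanks to which, in a word that avoids `321`, no letter of `c` is bumped
later. -/
structure IsBumpMatching (w b c : List ℕ) : Prop where
  perm : (insertionRow w ++ b).Perm w
  lt : List.Forall₂ (· < ·) c b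
  subperm : c.Subperm (insertionRow w)
  exists_gt : ∀ x ∈ c, ∃ y, x < y ∧ [y, x].Sublist w

theorem IsBumpMatching.append_singleton_of_none {w b c : List ℕ} {x : ℕ}
    (h : IsBumpMatching w b c) (hx : (rowInsert x (insertionRow w)).2 = none) :
    IsBumpMatching (w ++ [x]) b c := by
  have hrow : insertionRow (w ++ [x]) = insertionRow w ++ [x] := by
    rw [insertionRow_append_singleton, rowInsert_eq_none hx]
  refine ⟨?_, h.lt, ?_, fun z hz => ?_⟩
  · rw [hrow, List.append_assoc]
    refine (List.perm_append_comm.append_left _).trans ?_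
    rw [← List.append_assoc]
    exact h.perm.append_right _
  · rw [hrow]
    exact h.subperm.trans (List.sublist_append_left _ _).subperm
  · obtain ⟨y, hy, hs⟩ := h.exists_gt z hz
    exact ⟨y, hy, hs.trans (List.sublist_append_left _ _)⟩

theorem IsBumpMatching.append_singleton_of_some {w b c : List ℕ} {x y : ℕ}
    (h : IsBumpMatching w b c) (hx : (rowInsert x (insertionRow w)).2 = some y) (hy : y ∉ c) :
    IsBumpMatching (w ++ [x]) (y :: b) (x :: c) := by
  obtain ⟨hxy, hperm⟩ := rowInsert_eq_some hx
  rw [← insertionRow_append_singleton] at hperm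
  have hyw : y ∈ w := (insertionRow_subperm w).subset
    ((List.mem_cons.1 (hperm.subset List.mem_cons_self)).resolve_left hxy.ne')
  refine ⟨?_, .cons hxy h.lt, ?_, List.forall_mem_cons.2 ⟨⟨y, hxy, ?_⟩, fun z hz => ?_⟩⟩
  · refine List.perm_middle.trans ((hperm.append_right b).trans ?_)
    exact (h.perm.cons x).trans (List.perm_append_singleton x w).symm
  · have hcons : (x :: c).Subperm (y :: insertionRow (w ++ [x])) :=
      ((List.subperm_cons x).2 h.subperm).trans hperm.symm.subperm
    have hyxc : y ∉ x :: c := List.not_mem_cons_of_ne_of_not_mem hxy.ne' hy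
    have herase := hcons.erase y
    rwa [List.erase_cons_head, List.erase_of_not_mem hyxc] at herase
  · exact (List.singleton_sublist.2 hyw).append (List.Sublist.refl [x])
  · obtain ⟨t, ht, hs⟩ := h.exists_gt z hz
    exact ⟨t, ht, hs.trans (List.sublist_append_left _ _)⟩

theorem exists_isBumpMatching {w : List ℕ} (hw : Avoids [3, 2, 1] w) :
    ∃ b c, IsBumpMatching w b c := by
  induction w using List.reverseRecOn with
  | nil => exact ⟨[], [], List.Perm.refl _, .nil, List.Subperm.refl _, List.forall_mem_nil _⟩
  | append_singleton w x ih =>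
    obtain ⟨b, c, h⟩ := ih (hw.of_sublist (List.sublist_append_left _ _))
    cases hx : (rowInsert x (insertionRow w)).2 with
    | none => exact ⟨b, c, h.append_singleton_of_none hx⟩
    | some y =>
      refine ⟨y :: b, x :: c, h.append_singleton_of_some hx fun hyc => ?_⟩
      obtain ⟨z, hyz, hs⟩ := h.exists_gt y hyc
      rw [avoids_321_iff, triplewise_iff_forall_sublist] at hw
      exact (rowInsert_eq_some hx).1.not_ge (hw z y x (hs.append (List.Sublist.refl [x])) hyz)

theorem countP_le_of_forall₂_lt {c b : List ℕ} {p : ℕ → Bool}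
    (hp : Antitone p) (h : List.Forall₂ (· < ·) c b) :
    b.countP p ≤ c.countP p := by
  induction h with
  | nil => exact le_rfl
  | @cons x y _ _ hlt _ ih =>
    have hle : p y → p x := Bool.le_iff_imp.1 (hp hlt.le)
    rw [List.countP_cons, List.countP_cons]
    split_ifs with hy hx <;> first | omega | exact absurd (hle hy) hx

theorem countP_le_two_mul_countP_insertionRow {w : List ℕ} (hw : Avoids [3, 2, 1] w)
    {p : ℕ → Bool} (hp : Antitone p) :
    w.countP p ≤ 2 * (insertionRow w).countP p := by
  obtain ⟨b, c, h⟩ := exists_isBumpMatching hw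
  calc w.countP p = (insertionRow w).countP p + b.countP p := by
        rw [← h.perm.countP_eq p, List.countP_append]
    _ ≤ (insertionRow w).countP p + c.countP p := by
        gcongr
        exact countP_le_of_forall₂_lt hp h.lt
    _ ≤ 2 * (insertionRow w).countP p := by
        rw [two_mul]
        gcongr
        exact h.subperm.countP_le p

/-! ### The Dyck word of a 321-avoiding permutation -/

section RowWord

variable {α : Type*} {r : List ℕ} {m n : ℕ} {x y : α}

/-- The word `a₁ … aₙ` in which `aᵢ = x` if `i` belongs to the row `r`, and `aᵢ = y` otherwise. -/
def rowWord (n : ℕ) (r : List ℕ) (x y : α) : List α :=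
  (List.range' 1 n).map fun i => if i ∈ r then x else y

theorem length_rowWord (n : ℕ) (r : List ℕ) (x y : α) : (rowWord n r x y).length = n := by
  rw [rowWord, List.length_map, List.length_range']

theorem take_rowWord (p n : ℕ) (r : List ℕ) (x y : α) :
    (rowWord n r x y).take p = rowWord (min p n) r x y := by
  rw [rowWord, ← List.map_take, rowWord]
  rcases le_total p n with h | h
  · rw [List.take_range'_of_length_ge h, min_eq_left h]
  · rw [List.take_range'_of_length_le h, min_eq_right h]

theorem count_rowWord [DecidableEq α] (hr : r.Subperm (List.range' 1 m)) (hxy : x ≠ y) (n : ℕ) :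
    (rowWord n r x y).count x = r.countP fun i => decide (i ≤ n) := by
  have hmem : (rowWord n r x y).count x = (List.range' 1 n).countP fun i => decide (i ∈ r) := by
    rw [rowWord, List.count, List.countP_map]
    refine List.countP_congr fun i _ => ?_
    by_cases hi : i ∈ r <;> simp [hi, hxy.symm]
  have hnodup : r.Nodup := by
    obtain ⟨l, hl, hs⟩ := hr
    exact hl.nodup_iff.1 ((List.nodup_range' (step := 1)).sublist hs)
  rw [hmem, List.countP_eq_length_filter, List.countP_eq_length_filter]
  refine List.Perm.length_eq ((List.perm_ext_iff_of_nodup ((List.nodup_range' (step := 1)).filter _)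
    (hnodup.filter _)).2 fun i => ?_)
  have hpos : i ∈ r → 1 ≤ i := fun hi => (List.mem_range'_1.1 (hr.subset hi)).1
  simp only [List.mem_filter, List.mem_range'_1, decide_eq_true_eq]
  grind

theorem count_rowWord_eq_length [DecidableEq α] (hr : r.Subperm (List.range' 1 n)) (hxy : x ≠ y) :
    (rowWord n r x y).count x = r.length := by
  rw [count_rowWord hr hxy, List.countP_eq_length]
  intro i hi
  have := List.mem_range'_1.1 (hr.subset hi)
  exact decide_eq_true (by omega)

theorem rowWord_append_shift {s : List ℕ} (hr : ∀ i ∈ r, i ≤ m) (hs : ∀ i ∈ s, 1 ≤ i) (n : ℕ)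
    (x y : α) :
    rowWord (m + n) (r ++ shift s m) x y = rowWord m r x y ++ rowWord n s x y := by
  have hrange : List.range' (1 + m) n = (List.range' 1 n).map (m + ·) := by
    rw [List.map_add_range', add_comm]
  rw [rowWord, ← List.range'_append_1, List.map_append, hrange, List.map_map]
  refine congrArg₂ (· ++ ·) (List.map_congr_left fun i hi => ?_)
    (List.map_congr_left fun i hi => ?_)
  · have hi' : i ∉ shift s m := by
      rintro h
      obtain ⟨j, hj, rfl⟩ := List.mem_map.1 h
      have := hs j hj
      rw [List.mem_range'_1] at hi
      omega
    simp only [List.mem_append, hi', or_false]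
  · rw [Function.comp_apply, add_comm]
    have hi' : i + m ∉ r := fun h => by
      have := hr _ h
      rw [List.mem_range'_1] at hi
      omega
    simp only [List.mem_append, hi', false_or, shift, List.mem_map, add_left_inj,
      exists_eq_right]

end RowWord

theorem count_U_add_count_D (P : List DyckStep) : P.count U + P.count D = P.length := by
  induction P with
  | nil => rfl
  | cons x P ih =>
    rw [List.count_cons, List.count_cons, List.length_cons, ← ih]
    cases x
    · exact Nat.add_right_comm _ _ _
    · rfl

theorem exists_dyckWord_eq_append_reverse {L R : List DyckStep}
    (hL : ∀ p, (L.take p).count D ≤ (L.take p).count U)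
    (hR : ∀ p, (R.take p).count U ≤ (R.take p).count D)
    (hU : L.count U = R.count D) (hD : L.count D = R.count U) :
    ∃ P : DyckWord, P.toList = L ++ R.reverse := by
  refine ⟨⟨L ++ R.reverse, ?_, fun p => ?_⟩, rfl⟩
  · rw [List.count_append, List.count_append, List.count_reverse, List.count_reverse, hU, hD,
      add_comm]
  rcases le_or_gt p L.length with hp | hp
  · rw [List.take_append_of_le_length hp]
    exact hL p
  · obtain ⟨k, hk⟩ : ∃ k, R.reverse.take (p - L.length) = (R.drop k).reverse :=
      ⟨_, List.take_reverse⟩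
    have hsplit (x : DyckStep) : R.count x = (R.take k).count x + (R.drop k).count x := by
      rw [← List.count_append, List.take_append_drop]
    rw [List.take_append, List.take_of_length_le hp.le, hk, List.count_append, List.count_append,
      List.count_reverse, List.count_reverse]
    have := hR k
    have := hsplit U
    have := hsplit D
    omega

/-- The left half of `Psi w`. -/
def psiLeft (w : List ℕ) : List DyckStep := rowWord w.length (insertionRow w) U D

/-- The right half of `Psi w`, read from right to left. -/
def psiRight (w : List ℕ) : List DyckStep := rowWord w.length (recordingRow w) D U

theorem Psi_eq (w : List ℕ) : Psi w = psiLeft w ++ (psiRight w).reverse := by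
  rw [psiRight, rowWord, ← List.map_reverse]
  rfl

section Halves

variable {w : List ℕ}

theorem insertionRow_subperm_range' (hw : IsPermOf w.length w) :
    (insertionRow w).Subperm (List.range' 1 w.length) :=
  (insertionRow_subperm w).trans (List.Perm.subperm hw)

theorem countP_le_of_isPermOf (hw : IsPermOf w.length w) {p : ℕ} (hp : p ≤ w.length) :
    w.countP (fun i => decide (i ≤ p)) = p := by
  obtain ⟨k, hk⟩ := Nat.exists_eq_add_of_le hp
  rw [List.Perm.countP_eq _ hw, hk, ← List.range'_append_1, List.countP_append,
    List.countP_eq_length.2, List.countP_eq_zero.2, List.length_range', add_zero] <;>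
  · intro i hi
    rw [List.mem_range'_1] at hi
    simp only [decide_eq_true_eq]
    omega

theorem count_U_psiLeft (hw : IsPermOf w.length w) :
    (psiLeft w).count U = (psiRight w).count D := by
  rw [psiLeft, psiRight, count_rowWord_eq_length (insertionRow_subperm_range' hw) (by decide),
    count_rowWord_eq_length (recordingRow_sublist w).subperm (by decide), length_insertionRow]

theorem count_D_psiLeft (hw : IsPermOf w.length w) :
    (psiLeft w).count D = (psiRight w).count U := by
  have hL := count_U_add_count_D (psiLeft w)
  have hR := count_U_add_count_D (psiRight w)
  rw [psiLeft, length_rowWord, ← psiLeft] at hL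
  rw [psiRight, length_rowWord, ← psiRight] at hR
  have := count_U_psiLeft hw
  omega

theorem count_U_Psi (hw : IsPermOf w.length w) : (Psi w).count U = w.length := by
  rw [Psi_eq, List.count_append, List.count_reverse, ← count_D_psiLeft hw, count_U_add_count_D,
    psiLeft, length_rowWord]

theorem count_D_take_psiLeft_le (hw : IsPermOf w.length w) (ha : Avoids [3, 2, 1] w) (p : ℕ) :
    ((psiLeft w).take p).count D ≤ ((psiLeft w).take p).count U := by
  have hlen := count_U_add_count_D ((psiLeft w).take p)
  have hhalf := countP_le_two_mul_countP_insertionRow ha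
    (p := fun i => decide (i ≤ min p w.length)) fun i j hij =>
      Bool.le_iff_imp.2 (by simpa only [decide_eq_true_eq] using hij.trans)
  rw [countP_le_of_isPermOf hw (min_le_right _ _)] at hhalf
  simp only [psiLeft, take_rowWord, length_rowWord,
    count_rowWord (insertionRow_subperm_range' hw) (show U ≠ D by decide)] at hlen ⊢
  omega

theorem count_U_take_psiRight_le (ha : Avoids [3, 2, 1] w) (p : ℕ) :
    ((psiRight w).take p).count U ≤ ((psiRight w).take p).count D := by
  have hlen := count_U_add_count_D ((psiRight w).take p)
  have hhalf := countP_le_two_mul_countP_insertionRow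
    (ha.of_sublist (List.take_sublist (min p w.length) w)) (p := fun _ => true) antitone_const
  simp only [List.countP_true] at hhalf
  rw [List.length_take, min_eq_left (min_le_right _ _),
    length_insertionRow, recordingRow_take w (min_le_right _ _),
    ← List.countP_eq_length_filter] at hhalf
  simp only [psiRight, take_rowWord, length_rowWord,
    count_rowWord (recordingRow_sublist w).subperm (show D ≠ U by decide)] at hlen ⊢
  omega

theorem exists_dyckWord_eq_Psi (hw : IsPermOf w.length w) (ha : Avoids [3, 2, 1] w) :
    ∃ P : DyckWord, P.toList = Psi w := by
  rw [Psi_eq]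
  exact exists_dyckWord_eq_append_reverse (count_D_take_psiLeft_le hw ha)
    (count_U_take_psiRight_le ha) (count_U_psiLeft hw) (count_D_psiLeft hw)

end Halves

section DirectSum

variable {a b : List ℕ}

theorem directSum_append_singleton (a b : List ℕ) (x : ℕ) :
    directSum a (b ++ [x]) = directSum a b ++ [x + a.length] := by
  rw [directSum, directSum, shift, List.map_append, ← List.append_assoc]
  rfl

theorem rowInsert_insertionRow_append_shift (ha : ∀ x ∈ a, x ≤ a.length) (x : ℕ) (r : List ℕ) :
    rowInsert (x + a.length) (insertionRow a ++ shift r a.length) =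
      (insertionRow a ++ shift (rowInsert x r).1 a.length,
        (rowInsert x r).2.map (· + a.length)) := by
  rw [rowInsert_append fun y hy => ?_, rowInsert_shift]
  exact (ha y ((insertionRow_subperm a).subset hy)).trans (Nat.le_add_left _ _)

theorem insertionRow_directSum (ha : ∀ x ∈ a, x ≤ a.length) (b : List ℕ) :
    insertionRow (directSum a b) = insertionRow a ++ shift (insertionRow b) a.length := by
  induction b using List.reverseRecOn with
  | nil => exact congrArg insertionRow (List.append_nil a) |>.trans (List.append_nil _).symm
  | append_singleton b x ih =>
    rw [directSum_append_singleton, insertionRow_append_singleton, ih,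
      rowInsert_insertionRow_append_shift ha, insertionRow_append_singleton]

theorem recordingRow_directSum (ha : ∀ x ∈ a, x ≤ a.length) (b : List ℕ) :
    recordingRow (directSum a b) = recordingRow a ++ shift (recordingRow b) a.length := by
  induction b using List.reverseRecOn with
  | nil => exact congrArg recordingRow (List.append_nil a) |>.trans (List.append_nil _).symm
  | append_singleton b x ih =>
    rw [directSum_append_singleton, recordingRow_append_singleton, ih,
      insertionRow_directSum ha, rowInsert_insertionRow_append_shift ha,
      recordingRow_append_singleton, length_directSum]
    simp only [Option.map_eq_none_iff]
    split_ifs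
    · rw [shift, shift, List.map_append, List.append_assoc, List.map_singleton, add_assoc,
        add_comm a.length]
    · rfl

theorem Psi_directSum (ha : IsPermOf a.length a) (hb : ∀ x ∈ b, 1 ≤ x) :
    Psi (directSum a b) = psiLeft a ++ (Psi b ++ (psiRight a).reverse) := by
  have hle : ∀ x ∈ a, x ≤ a.length := fun x hx => (ha.mem_iff.1 hx).2
  have hleft : psiLeft (directSum a b) = psiLeft a ++ psiLeft b := by
    rw [psiLeft, insertionRow_directSum hle, length_directSum, rowWord_append_shift]
    · rfl
    · exact fun i hi => hle i ((insertionRow_subperm a).subset hi)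
    · exact fun i hi => hb i ((insertionRow_subperm b).subset hi)
  have hright : psiRight (directSum a b) = psiRight a ++ psiRight b := by
    rw [psiRight, recordingRow_directSum hle, length_directSum, rowWord_append_shift]
    · rfl
    · intro i hi
      have := List.mem_range'_1.1 ((recordingRow_sublist a).subset hi)
      omega
    · exact fun i hi => (List.mem_range'_1.1 ((recordingRow_sublist b).subset hi)).1
  rw [Psi_eq, hleft, hright, Psi_eq, List.reverse_append]
  simp only [List.append_assoc]

end DirectSum

/-! ### The map `Θ` -/

theorem Theta_mem_avoidersOf {n : ℕ} {σ : List ℕ} (h : σ ∈ avoidersOf [3, 2, 1] n) :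
    Theta σ ∈ avoidersOf [1, 3, 2] n := by
  obtain ⟨hσ, ha⟩ := h
  obtain rfl := hσ.length_eq
  obtain ⟨P, hP⟩ := exists_dyckWord_eq_Psi hσ ha
  rw [Theta, ← hP, ← count_U_Psi hσ, ← hP]
  exact PhiInv_mem_avoidersOf P

theorem Theta_directSum {σ τ : List ℕ} (hσ : σ ∈ avoiders [3, 2, 1])
    (hτ : τ ∈ avoiders [3, 2, 1]) :
    Theta (directSum σ τ) = directProd (Theta τ) (Theta σ) := by
  rw [mem_avoiders_iff] at hσ hτ
  obtain ⟨P, hP⟩ := exists_dyckWord_eq_Psi hσ.1 hσ.2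
  obtain ⟨E, hE⟩ := exists_dyckWord_eq_Psi hτ.1 hτ.2
  have hcount : (psiLeft σ).count D = (psiRight σ).reverse.count U := by
    rw [List.count_reverse, count_D_psiLeft hσ.1]
  rw [Theta, Theta, Theta, Psi_directSum hσ.1 fun x hx => (hτ.1.mem_iff.1 hx).1, ← hE, Psi_eq σ]
  exact PhiInv_insert (hP.trans (Psi_eq σ)) hcount E

end PermWord

theorem mainTheorem11_general :
    (∀ n : ℕ, ∀ σ ∈ PermWord.avoidersOf [3, 2, 1] n,
      PermWord.Theta σ ∈ PermWord.avoidersOf [1, 3, 2] n) ∧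
    (∀ σ₁ ∈ PermWord.avoiders [3, 2, 1], ∀ σ₂ ∈ PermWord.avoiders [3, 2, 1],
      PermWord.directSum σ₁ σ₂ ∈ PermWord.avoiders [3, 2, 1] ∧
      PermWord.Theta (PermWord.directSum σ₁ σ₂) =
        PermWord.directProd (PermWord.Theta σ₂) (PermWord.Theta σ₁)) ∧
    (∀ α ∈ PermWord.avoiders [1, 3, 2], ∀ β ∈ PermWord.avoiders [1, 3, 2],
      PermWord.directProd α β ∈ PermWord.avoiders [1, 3, 2]) ∧
    (∀ α : List ℕ, ∀ β ∈ PermWord.avoiders [1, 3, 2], ∀ γ ∈ PermWord.avoiders [1, 3, 2],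
      PermWord.directProd (PermWord.directProd α β) γ =
        PermWord.directProd α (PermWord.directProd β γ)) ∧
    (∀ α β : List ℕ, PermWord.IsPermOf α.length α → PermWord.IsPermOf β.length β →
      PermWord.crs (PermWord.directProd α β) = PermWord.crs α + PermWord.crs β) :=
  ⟨fun _ _ => PermWord.Theta_mem_avoidersOf,
    fun _ h₁ _ h₂ => ⟨PermWord.directSum_mem_avoiders h₁ h₂, PermWord.Theta_directSum h₁ h₂⟩,
    fun _ hα _ hβ => PermWord.directProd_mem_avoiders hα hβ,
    fun α _ hβ _ hγ => PermWord.directProd_assoc α hβ hγ,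
    fun _ β hα _ => PermWord.crs_directProd (fun _ => hα.mem_iff.1) β⟩

theorem mainTheorem11 :
    -- `Θ` maps `S_n(321)` to `S_n(132)`
    (∀ n : ℕ, ∀ σ ∈ PermWord.avoidersOf [3, 2, 1] n,
      PermWord.Theta σ ∈ PermWord.avoidersOf [1, 3, 2] n) ∧
    -- `S(321)` is closed under `⊕`, and `Θ(σ₁ ⊕ σ₂) = Θ(σ₂) ⊗ Θ(σ₁)`
    (∀ σ₁ ∈ PermWord.avoiders [3, 2, 1], ∀ σ₂ ∈ PermWord.avoiders [3, 2, 1],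
      PermWord.directSum σ₁ σ₂ ∈ PermWord.avoiders [3, 2, 1] ∧
      PermWord.Theta (PermWord.directSum σ₁ σ₂) =
        PermWord.directProd (PermWord.Theta σ₂) (PermWord.Theta σ₁)) ∧
    -- `S(132)` is closed under `⊗`
    (∀ α ∈ PermWord.avoiders [1, 3, 2], ∀ β ∈ PermWord.avoiders [1, 3, 2],
      PermWord.directProd α β ∈ PermWord.avoiders [1, 3, 2]) ∧
    -- `⊗` is associative on `S(132)`
    (∀ α ∈ PermWord.avoiders [1, 3, 2], ∀ β ∈ PermWord.avoiders [1, 3, 2],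
      ∀ γ ∈ PermWord.avoiders [1, 3, 2],
      PermWord.directProd (PermWord.directProd α β) γ =
        PermWord.directProd α (PermWord.directProd β γ)) ∧
    -- crossings are additive under `⊗`
    (∀ α ∈ PermWord.avoiders [1, 3, 2], ∀ β ∈ PermWord.avoiders [1, 3, 2],
      PermWord.crs (PermWord.directProd α β) = PermWord.crs α + PermWord.crs β) := by
  obtain ⟨hTheta, hsum, hprod, hassoc, hcrs⟩ := mainTheorem11_general
  exact ⟨hTheta, hsum, hprod, fun α _ => hassoc α, fun α hα β hβ =>
    hcrs α β (PermWord.mem_avoiders_iff.1 hα).1 (PermWord.mem_avoiders_iff.1 hβ).1⟩
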